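/- Let $k$ be any field, let $d \ge 1$, let $R = k[x_1,\dots,x_d]$, and let $I \subseteq R$ be an unmixed ideal, that is, an ideal without embedded primes: every associated prime of $R/I$ is minimal over $I$ (for example, $I$ may be prime). For $N \in \mathbb N$ let $I^{(N)}$ denote the $N$-th symbolic power of $I$, that is, the intersection of the primary components of $I^N$ that belong to the minimal primes of $I^N$; equivalently, $$I^{(N)} = \bigcap_{P} \left(I^N R_P \cap R\right),$$ where $P$ runs through the minimal primes of $I^N$ (so $\mathfrak p^{(N)} = \mathfrak p^N R_{\mathfrak p} \cap R$ for a prime ideal $\mathfrak p$ and $N \ge 1$). Then $$I^{(dn)} \subseteq I^n \quad \text{for all } n \in \mathbb N .$$ -/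

import Mathlib

namespace Ideal

variable {R : Type*} [CommRing R]

/-- An ideal `I` is unmixed if it has no embedded primes: every associated prime of `R ⧸ I` is
minimal over `I`. -/
def IsUnmixed (I : Ideal R) : Prop :=
  ∀ P ∈ associatedPrimes R (R ⧸ I), P ∈ I.minimalPrimes

theorem IsPrime.isUnmixed {P : Ideal R} (hP : P.IsPrime) : P.IsUnmixed := by
  intro Q hQ
  have hle : P ≤ Q := by
    have := hQ.annihilator_le
    rwa [Submodule.annihilator_top, annihilator_quotient] at this
  obtain ⟨hQp, x, rfl⟩ := hQ
  refine ⟨⟨hQp, hle⟩, fun J hJ _ => ?_⟩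
  obtain ⟨y, rfl⟩ := Quotient.mk_surjective x
  refine le_trans ?_ hJ.2
  rw [hP.radical_le_iff]
  intro r hr
  rw [Submodule.mem_colon_singleton] at hr
  have hry : r * y ∈ P := by
    rw [← Quotient.eq_zero_iff_mem, map_mul]
    exact (Submodule.mem_bot R).mp hr
  refine (hP.mem_or_mem hry).resolve_right fun hy => hQp.ne_top ?_
  rw [Quotient.eq_zero_iff_mem.mpr hy, eq_top_iff]
  exact fun r _ => le_radical (by simp)

/-- For a prime `P`, the contraction `J R_P ∩ R`. If `P` is a minimal prime of `J`, this is the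
`P`-primary component of `J`. -/
def localContraction (J P : Ideal R) [P.IsPrime] : Ideal R :=
  (J.map (algebraMap R (Localization.AtPrime P))).comap (algebraMap R (Localization.AtPrime P))

/-- The symbolic power `I^(N)`: the intersection of the minimal primary components of `I ^ N`, that
is, of `I ^ N R_P ∩ R` for `P` running through the minimal primes of `I ^ N`. The lemma
`symbolicPower_eq_iInf_of_isMinimalPrimaryDecomposition` gives the description by a primary
decomposition, the lemma `symbolicPower_of_isPrime` the case of a prime ideal. -/
def symbolicPower (I : Ideal R) (N : ℕ) : Ideal R :=
  ⨅ (P : Ideal R) (hP : P ∈ (I ^ N).minimalPrimes),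
    haveI : P.IsPrime := hP.1.1
    localContraction (I ^ N) P

theorem mem_localContraction {J P : Ideal R} [P.IsPrime] {x : R} :
    x ∈ localContraction J P ↔ ∃ s, s ∉ P ∧ s * x ∈ J := by
  rw [localContraction, mem_comap, IsLocalization.algebraMap_mem_map_algebraMap_iff P.primeCompl]
  simp only [mem_primeCompl_iff]

/-- In a minimal primary decomposition of `J`, the component belonging to a minimal prime `P` of `J`
is `J R_P ∩ R`. -/
theorem localContraction_eq_of_isMinimalPrimaryDecomposition {J : Ideal R} {t : Finset (Ideal R)}
    (ht : Submodule.IsMinimalPrimaryDecomposition J t) {q : Ideal R} (hq : q ∈ t)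
    (hmin : q.radical ∈ J.minimalPrimes) :
    haveI : q.radical.IsPrime := hmin.1.1
    localContraction J q.radical = q := by
  classical
  have hP : q.radical.IsPrime := hmin.1.1
  ext x
  rw [mem_localContraction]
  have hJ : ∀ q' ∈ t, J ≤ q' := fun q' h => ht.inf_eq.symm.trans_le (Finset.inf_le h)
  constructor
  · rintro ⟨s, hs, hsx⟩
    have hp : q.IsPrimary := ht.primary hq
    have h1 : x * s ∈ q := by rw [mul_comm]; exact hJ q hq hsx
    exact ((isPrimary_iff.mp hp).2 h1).resolve_right hs
  · intro hx
    have key : ∀ q' : Ideal R, ∃ s, s ∉ q.radical ∧ (q' ∈ t → q' ≠ q → s ∈ q') := by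
      intro q'
      by_cases h : q' ∈ t ∧ q' ≠ q
      · have hnot : ¬ q' ≤ q.radical := by
          intro hle
          have hr : q'.radical ≤ q.radical := hP.radical_le_iff.mpr hle
          have hpr : q'.radical.IsPrime := isPrime_radical (ht.primary h.1)
          have he : q'.radical = q.radical :=
            le_antisymm hr (hmin.2 ⟨hpr, (hJ q' h.1).trans le_radical⟩ hr)
          have := ht.distinct h.1 hq h.2
          simp [Function.onFun, Submodule.colon_univ, he] at this
        obtain ⟨s, h1, h2⟩ := SetLike.not_le_iff_exists.mp hnot
        exact ⟨s, h2, fun _ _ => h1⟩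
      · exact ⟨1, (ne_top_iff_one _).mp hP.ne_top, fun h1 h2 => absurd ⟨h1, h2⟩ h⟩
    choose s hs hs' using key
    refine ⟨∏ q' ∈ t, s q', ?_, ?_⟩
    · intro h
      obtain ⟨q', _, h2⟩ := hP.prod_mem_iff.mp h
      exact hs q' h2
    · rw [← ht.inf_eq, Submodule.mem_finsetInf]
      intro q' hq'
      by_cases h : q' = q
      · subst h; exact mul_mem_left _ _ hx
      · exact mul_mem_right _ _ (mem_of_dvd _ (Finset.dvd_prod_of_mem s hq') (hs' q' hq' h))

/-- For every minimal primary decomposition `t` of `I ^ N`, the symbolic power is the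
intersection of the components in `t` whose radical is a minimal prime. -/
theorem symbolicPower_eq_iInf_of_isMinimalPrimaryDecomposition (I : Ideal R) (N : ℕ)
    {t : Finset (Ideal R)} (ht : Submodule.IsMinimalPrimaryDecomposition (I ^ N) t) :
    symbolicPower I N = ⨅ q ∈ {q ∈ (t : Set (Ideal R)) | q.radical ∈ (I ^ N).minimalPrimes}, q := by
  apply le_antisymm
  · refine le_iInf₂ fun q hq => (iInf₂_le q.radical hq.2).trans ?_
    exact (localContraction_eq_of_isMinimalPrimaryDecomposition ht hq.1 hq.2).le
  · refine le_iInf₂ fun P hP => ?_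
    obtain ⟨q, hq, rfl⟩ := IsMinimalPrimaryDecomposition.minimalPrimes_subset_image_radical ht hP
    exact (iInf₂_le q ⟨hq, hP⟩).trans
      (localContraction_eq_of_isMinimalPrimaryDecomposition ht hq hP).ge

/-- For a prime ideal `P` and `N ≠ 0`, the symbolic power is `P ^ N R_P ∩ R`. -/
theorem symbolicPower_of_isPrime (P : Ideal R) [hP : P.IsPrime] {N : ℕ} (hN : N ≠ 0) :
    symbolicPower P N = localContraction (P ^ N) P := by
  have h : (P ^ N).minimalPrimes = {P} := by
    rw [← radical_minimalPrimes, radical_pow _ hN, hP.radical,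
      minimalPrimes_eq_subsingleton_self]
  apply le_antisymm
  · exact iInf₂_le P (by rw [h]; rfl)
  · refine le_iInf₂ fun Q hQ => ?_
    obtain rfl : Q = P := by rw [h] at hQ; exact hQ
    exact le_rfl

end Ideal

/-! Write `q = p ^ e` and let `I^[q]` be the ideal generated by the `q`-th powers of elements of
`I`. An element `u` of the symbolic power satisfies `s * u ∈ I ^ (d * n)` for some nonzerodivisor
`s` modulo `I`: by unmixedness, prime avoidance finds `s` outside all associated primes.

Over an infinite field, `I` has, up to an element `w`, a reduction `J` with `d` generators: `w
I^(t+1) ⊆ J I^t`. The reason is that the special fibre of the Rees algebra has dimension at most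
`d`. Nakayama's lemma gives `w ≡ 1` modulo any prescribed `b ≠ 0`. With `b = u ^ n ∈ I ^ n` it
suffices to show `w ^ (d * n) * u ∈ I ^ n`.

In characteristic `p` over a perfect field this is a tight closure argument. By pigeonhole `J^(dq) ⊆
I^[q]`, so with `a = q / n` a fixed power of `u` times `s^a w^(dq) u^a` lies in `I^[q]`. Frobenius
is flat, so `s^a` cancels; taking `n`-th powers yields `c (w^(dn) u)^q ∈ (I^n)^[q]` with `c ≠ 0`
independent of `q`. Freeness over the `q`-th powers then removes `c`
(`mem_of_forall_mul_pow_mem_map_iterateFrobenius`).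

For any other field the data descend to a finitely generated domain over `ℤ`. Generic freeness
transfers the nonzerodivisor `s` and a failing conclusion to a finite residue field, which is
perfect of positive characteristic. -/

namespace MvPolynomial

/-! ### Frobenius powers of ideals over a perfect field -/

section FrobeniusComponents

variable {σ F : Type*} [Field F] (p : ℕ) [Fact p.Prime] [CharP F p] [PerfectRing F p] (e : ℕ)

/-- The components of a polynomial with respect to the basis of monomials with exponents
below `p ^ e` over the subring of `p ^ e`-th powers. -/
noncomputable def frobeniusComponent (α : σ → Fin (p ^ e)) [Finite σ] (h : MvPolynomial σ F) :
    MvPolynomial σ F :=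
  AddMonoidAlgebra.ofCoeff
    ((Finsupp.comapDomain
        (fun β : σ →₀ ℕ => Finsupp.equivFunOnFinite.symm (fun i => (α i : ℕ)) + p ^ e • β)
        (AddMonoidAlgebra.coeff h)
        (fun a _ b _ hab => by
          have hp : p ^ e ≠ 0 := pow_ne_zero _ (Fact.out : p.Prime).ne_zero
          exact smul_right_injective _ hp (add_left_cancel hab))).mapRange
      (iterateFrobeniusEquiv F p e).symm (map_zero _))

variable [Finite σ]

theorem coeff_frobeniusComponent (α : σ → Fin (p ^ e)) (h : MvPolynomial σ F) (β : σ →₀ ℕ) :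
    coeff β (frobeniusComponent p e α h) = (iterateFrobeniusEquiv F p e).symm
      (coeff (Finsupp.equivFunOnFinite.symm (fun i => (α i : ℕ)) + p ^ e • β) h) := rfl

theorem frobeniusComponent_add (α : σ → Fin (p ^ e)) (g h : MvPolynomial σ F) :
    frobeniusComponent p e α (g + h) =
      frobeniusComponent p e α g + frobeniusComponent p e α h := by
  ext β; simp [coeff_frobeniusComponent]

theorem frobeniusComponent_zero (α : σ → Fin (p ^ e)) :
    frobeniusComponent p e α (0 : MvPolynomial σ F) = 0 := by
  ext β; simp [coeff_frobeniusComponent]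

theorem frobeniusComponent_pow_mul (α : σ → Fin (p ^ e)) (r h : MvPolynomial σ F) :
    frobeniusComponent p e α (r ^ p ^ e * h) = r * frobeniusComponent p e α h := by
  have hq : 0 < p ^ e := pow_pos (Fact.out : p.Prime).pos _
  induction r using MvPolynomial.induction_on' with
  | add a b ha hb =>
    rw [add_pow_char_pow, add_mul, add_mul, frobeniusComponent_add, ha, hb]
  | monomial β c =>
    ext δ
    rw [coeff_frobeniusComponent, monomial_pow, coeff_monomial_mul', coeff_monomial_mul']
    have hle : p ^ e • β ≤ Finsupp.equivFunOnFinite.symm (fun i => (α i : ℕ)) + p ^ e • δ ↔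
        β ≤ δ := by
      simp only [Finsupp.le_def]
      refine forall_congr' fun i => ?_
      simp only [Finsupp.smul_apply, Finsupp.add_apply, Finsupp.equivFunOnFinite_symm_apply_apply,
        smul_eq_mul]
      constructor
      · intro hi
        by_contra! hlt
        have h1 := (α i).2
        have h2 : p ^ e * (δ i + 1) ≤ p ^ e * β i := Nat.mul_le_mul_left _ hlt
        rw [mul_add] at h2
        omega
      · intro hi
        exact le_add_left (Nat.mul_le_mul_left _ hi)
    simp only [hle]
    split_ifs with hb
    · rw [map_mul, coeff_frobeniusComponent, ← iterateFrobeniusEquiv_def,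
        RingEquiv.symm_apply_apply]
      congr 3
      obtain ⟨η, rfl⟩ := le_iff_exists_add.mp hb
      rw [add_tsub_cancel_left, smul_add, add_left_comm, add_tsub_cancel_left]
    · exact map_zero _

open Classical in
theorem sum_frobeniusComponent [Fintype σ] (h : MvPolynomial σ F) :
    ∑ α : σ → Fin (p ^ e), frobeniusComponent p e α h ^ p ^ e *
      monomial (Finsupp.equivFunOnFinite.symm (fun i => (α i : ℕ))) 1 = h := by
  have hq : 0 < p ^ e := pow_pos (Fact.out : p.Prime).pos _
  induction h using MvPolynomial.induction_on' with
  | add a b ha hb =>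
    simp_rw [frobeniusComponent_add, add_pow_char_pow, add_mul, Finset.sum_add_distrib]
    rw [ha, hb]
  | monomial γ c =>
    let α₀ : σ → Fin (p ^ e) := fun i => ⟨γ i % p ^ e, Nat.mod_lt _ hq⟩
    let γ' : σ →₀ ℕ := Finsupp.equivFunOnFinite.symm (fun i => γ i / p ^ e)
    have hγ : Finsupp.equivFunOnFinite.symm (fun i => (α₀ i : ℕ)) + p ^ e • γ' = γ := by
      ext i; simp [α₀, γ', Nat.mod_add_div]
    have key : ∀ (α : σ → Fin (p ^ e)) (β : σ →₀ ℕ),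
        Finsupp.equivFunOnFinite.symm (fun i => (α i : ℕ)) + p ^ e • β = γ → α = α₀ ∧ β = γ' := by
      intro α β h
      have hi : ∀ i, (α i : ℕ) + p ^ e * β i = γ i := fun i => by
        simpa using DFunLike.congr_fun h i
      constructor
      · ext i
        simp only [α₀, ← hi i]
        rw [Nat.add_mul_mod_self_left, Nat.mod_eq_of_lt (α i).2]
      · ext i
        simp only [γ', Finsupp.equivFunOnFinite_symm_apply_apply, ← hi i]
        rw [Nat.add_mul_div_left _ _ hq, Nat.div_eq_of_lt (α i).2, zero_add]
    rw [Finset.sum_eq_single α₀]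
    · have : frobeniusComponent p e α₀ (monomial γ c) =
          monomial γ' ((iterateFrobeniusEquiv F p e).symm c) := by
        ext β
        rw [coeff_frobeniusComponent, coeff_monomial, coeff_monomial]
        by_cases hb : γ' = β
        · subst hb; rw [if_pos hγ.symm, if_pos rfl]
        · rw [if_neg, if_neg hb, map_zero]
          exact fun h => hb (key _ _ h.symm).2.symm
      rw [this, monomial_pow, monomial_mul, ← iterateFrobeniusEquiv_def,
        RingEquiv.apply_symm_apply, mul_one, add_comm, hγ]
    · intro α _ hα
      have : frobeniusComponent p e α (monomial γ c) = 0 := by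
        ext β
        rw [coeff_frobeniusComponent, coeff_monomial, if_neg, map_zero, coeff_zero]
        exact fun h => hα (key _ _ h.symm).1
      rw [this, zero_pow hq.ne', zero_mul]
    · simp

/-- The ring is free over its `p ^ e`-th powers, so the Frobenius power of `I` can be tested
coordinate by coordinate. -/
theorem mem_map_iterateFrobenius_iff (I : Ideal (MvPolynomial σ F)) (h : MvPolynomial σ F) :
    h ∈ I.map (iterateFrobenius (MvPolynomial σ F) p e) ↔
      ∀ α, frobeniusComponent p e α h ∈ I := by
  have := Fintype.ofFinite σ
  constructor
  · intro hh α
    -- Components are not linear over the whole ring, so the induction carries an arbitrary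
    -- multiplier.
    suffices H : ∀ r, frobeniusComponent p e α (r * h) ∈ I by simpa using H 1
    induction hh using Submodule.span_induction with
    | mem x hx =>
      obtain ⟨y, hy, rfl⟩ := hx
      intro r
      rw [iterateFrobenius_def, mul_comm, frobeniusComponent_pow_mul]
      exact I.mul_mem_right _ hy
    | zero => intro r; rw [mul_zero, frobeniusComponent_zero]; exact I.zero_mem
    | add x y _ _ hx hy =>
      intro r
      rw [mul_add, frobeniusComponent_add]
      exact I.add_mem (hx r) (hy r)
    | smul s x _ hx => intro r; rw [smul_eq_mul, ← mul_assoc]; exact hx _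
  · intro hh
    rw [← sum_frobeniusComponent p e h]
    refine Ideal.sum_mem _ fun α _ => Ideal.mul_mem_right _ _ ?_
    exact Ideal.mem_map_of_mem (iterateFrobenius (MvPolynomial σ F) p e) (hh α)

/-- Flatness of Frobenius: a nonzerodivisor modulo `I` is one modulo `I ^ [q]`. -/
theorem mem_map_iterateFrobenius_of_mul_mem {I : Ideal (MvPolynomial σ F)} {s : MvPolynomial σ F}
    (hs : ∀ h, s * h ∈ I → h ∈ I) {h : MvPolynomial σ F}
    (hh : s * h ∈ I.map (iterateFrobenius (MvPolynomial σ F) p e)) :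
    h ∈ I.map (iterateFrobenius (MvPolynomial σ F) p e) := by
  have hq : 0 < p ^ e := pow_pos (Fact.out : p.Prime).pos _
  -- Only `p ^ e`-th powers pass through the components, hence `s` is raised to one.
  have h1 : s ^ p ^ e * h ∈ I.map (iterateFrobenius (MvPolynomial σ F) p e) := by
    rw [← Nat.succ_pred_eq_of_pos hq, pow_succ, mul_assoc]
    exact Ideal.mul_mem_left _ _ hh
  rw [mem_map_iterateFrobenius_iff] at h1 ⊢
  intro α
  refine hs _ ?_
  rw [← frobeniusComponent_pow_mul]
  exact h1 α

/-- Ideals of polynomial rings over perfect fields are tightly closed. -/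
theorem mem_of_forall_mul_pow_mem_map_iterateFrobenius {I : Ideal (MvPolynomial σ F)}
    {c u : MvPolynomial σ F} (hc : c ≠ 0)
    (h : ∀ e, c * u ^ p ^ e ∈ I.map (iterateFrobenius (MvPolynomial σ F) p e)) : u ∈ I := by
  have hp : 1 < p := (Fact.out : p.Prime).one_lt
  obtain ⟨γ, hγ⟩ := ne_zero_iff.mp hc
  -- Once `p ^ e` exceeds the degree of `c`, the components of `c` are constants; one nonzero
  -- constant then gives `u ∈ I`.
  obtain ⟨e, he⟩ : ∃ e, c.totalDegree < p ^ e := ⟨_, Nat.lt_pow_self hp⟩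
  have hlt : ∀ γ' : σ →₀ ℕ, coeff γ' c ≠ 0 → ∀ i, γ' i < p ^ e := fun γ' h' i =>
    ((Finsupp.le_degree i γ').trans (le_totalDegree (mem_support_iff.mpr h'))).trans_lt he
  let α : σ → Fin (p ^ e) := fun i => ⟨γ i, hlt γ hγ i⟩
  have hcomp : frobeniusComponent p e α c =
      C ((iterateFrobeniusEquiv F p e).symm (coeff γ c)) := by
    classical
    ext β
    rw [coeff_frobeniusComponent, coeff_C]
    have hα : Finsupp.equivFunOnFinite.symm (fun i => (α i : ℕ)) = γ := by ext i; simp [α]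
    rw [hα]
    split_ifs with hb
    · rw [← hb, smul_zero, add_zero]
    · by_contra hne
      rw [EmbeddingLike.map_eq_zero_iff] at hne
      obtain ⟨i, hi⟩ := Finsupp.ne_iff.mp (Ne.symm hb)
      have := hlt _ hne i
      simp only [Finsupp.add_apply, Finsupp.smul_apply, smul_eq_mul, Finsupp.zero_apply] at this hi
      have h2 : p ^ e * 1 ≤ p ^ e * β i := Nat.mul_le_mul_left _ (Nat.pos_of_ne_zero hi)
      omega
  have h1 := (mem_map_iterateFrobenius_iff p e I _).mp (h e) α
  rw [mul_comm, frobeniusComponent_pow_mul, hcomp, mul_comm] at h1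
  refine (Ideal.unit_mul_mem_iff_mem _ (IsUnit.map C (IsUnit.mk0 _ ?_))).mp h1
  rwa [Ne, EmbeddingLike.map_eq_zero_iff]

end FrobeniusComponents

end MvPolynomial

/-! ### Powers of reductions and the containment in characteristic `p` -/

namespace Ideal

section Reductions

variable {R : Type*} [CommRing R]

/-- Pigeonhole: a monomial of degree `s.card * q` has some exponent at least `q`. For empty `s` the
left side would be the unit ideal. -/
theorem iSup_span_singleton_pow_le {ι : Type*} (j : ι → R) (q : ℕ) {s : Finset ι}
    (hs : s.Nonempty) :
    (⨆ i ∈ s, span {j i}) ^ (s.card * q) ≤ ⨆ i ∈ s, span {j i ^ q} := by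
  classical
  induction hs using Finset.Nonempty.cons_induction with
  | singleton a => simp [span_singleton_pow]
  | cons a s ha hs ih =>
    rw [Finset.card_cons, Finset.cons_eq_insert, Finset.iSup_insert, Finset.iSup_insert,
      add_mul, one_mul, add_comm]
    refine sup_pow_add_le_pow_sup_pow.trans ?_
    rw [span_singleton_pow]
    exact sup_le_sup_left ih _

theorem span_range_pow_card_mul_le {d : ℕ} (hd : 0 < d) (j : Fin d → R) (q : ℕ) :
    span (Set.range j) ^ (d * q) ≤ span (Set.range fun i => j i ^ q) := by
  have : Nonempty (Fin d) := ⟨⟨0, hd⟩⟩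
  simpa [span, Submodule.span_range_eq_iSup] using
    iSup_span_singleton_pow_le j q (Finset.univ_nonempty (α := Fin d))

/-- Each factor `w` trades one factor `I` for a factor `J`. -/
theorem span_singleton_pow_mul_pow_le {I J : Ideal R} {w : R} {t : ℕ}
    (h : span {w} * I ^ (t + 1) ≤ J * I ^ t) (N : ℕ) :
    span {w ^ N} * I ^ (t + N) ≤ J ^ N * I ^ t := by
  induction N with
  | zero => simp
  | succ N ih =>
    calc span {w ^ (N + 1)} * I ^ (t + (N + 1))
        = span {w} * (span {w ^ N} * I ^ (t + N)) * I := by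
          rw [← span_singleton_pow, ← span_singleton_pow]; ring
      _ ≤ span {w} * (J ^ N * I ^ t) * I := by gcongr
      _ = J ^ N * (span {w} * I ^ (t + 1)) := by ring
      _ ≤ J ^ N * (J * I ^ t) := by gcongr
      _ = J ^ (N + 1) * I ^ t := by ring

end Reductions

open MvPolynomial in
/-- The containment of symbolic powers in positive characteristic, with the hypotheses made
explicit: `s` witnesses that `u` is in the symbolic power, and `j` generates a reduction of `I`
where `w` is inverted. -/
theorem pow_mul_mem_pow_of_perfectRing {F : Type*} [Field F] (p : ℕ) [Fact p.Prime] [CharP F p]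
    [PerfectRing F p] {σ : Type*} [Finite σ] {d n t : ℕ} (hd : 0 < d) (hn : 0 < n)
    {I : Ideal (MvPolynomial σ F)} {s u w : MvPolynomial σ F} (hs : ∀ h, s * h ∈ I → h ∈ I)
    (hsu : s * u ∈ I ^ (d * n)) (j : Fin d → MvPolynomial σ F) (hj : ∀ i, j i ∈ I)
    (hw : span {w} * I ^ (t + 1) ≤ span (Set.range j) * I ^ t) :
    w ^ (d * n) * u ∈ I ^ n := by
  have hsu1 : u ∈ I := hs u (pow_le_self (Nat.mul_pos hd hn).ne' hsu)
  by_cases hu : u = 0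
  · rw [hu, mul_zero]; exact zero_mem _
  -- In `c`, the summand `d * n` pays for rounding in `q / n`, `t` for the reduction, and the factor
  -- `n` for the final `n`-th power.
  refine mem_of_forall_mul_pow_mem_map_iterateFrobenius p
    (c := u ^ ((d * n + t) * n)) (pow_ne_zero _ hu) fun e => ?_
  set Φ := iterateFrobenius (MvPolynomial σ F) p e
  set q := p ^ e with hq
  set a := q / n with ha
  have han : n * a ≤ q := Nat.mul_div_le q n
  have hqa : q ≤ n * a + n := by
    have h0 := Nat.div_add_mod q n
    rw [← ha] at h0
    have := Nat.mod_lt q hn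
    omega
  have hJ : span (Set.range j) ^ (d * q) ≤ I.map Φ := by
    refine (span_range_pow_card_mul_le hd j q).trans (span_le.mpr ?_)
    rintro _ ⟨i, rfl⟩
    exact mem_map_of_mem Φ (hj i)
  have h1 : (s * u) ^ a * u ^ (d * n + t) ∈ I ^ (t + d * q) := by
    have h2 : (s * u) ^ a * u ^ (d * n + t) ∈ I ^ (d * n * a + (d * n + t)) := by
      rw [pow_add I, pow_mul I]
      exact mul_mem_mul (pow_mem_pow hsu a) (pow_mem_pow hsu1 _)
    refine pow_le_pow_right ?_ h2
    have := Nat.mul_le_mul_left d hqa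
    rw [mul_add, ← mul_assoc] at this
    omega
  have h2 : s ^ a * (w ^ (d * q) * u ^ a * u ^ (d * n + t)) ∈ I.map Φ := by
    have h3 := (span_singleton_pow_mul_pow_le hw (d * q)).trans (Ideal.mul_le_left.trans hJ)
      (mul_mem_mul (mem_span_singleton_self _) h1)
    convert h3 using 1
    ring
  have h3 : w ^ (d * q) * u ^ a * u ^ (d * n + t) ∈ I.map Φ := by
    generalize w ^ (d * q) * u ^ a * u ^ (d * n + t) = y at h2
    clear_value a
    clear h1 han hqa ha
    induction a with
    | zero => simpa using h2
    | succ a ih =>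
      refine ih ?_
      refine mem_map_iterateFrobenius_of_mul_mem p e hs ?_
      convert h2 using 1
      ring
  -- The `n`-th power of `I^[q]` is `(I^n)^[q]`; the factor `u ^ (q - n * a)` completes `u ^ (n *
  -- a)` to `u ^ q`.
  have h4 := pow_mem_pow h3 n
  rw [← Ideal.map_pow] at h4
  have h5 := Ideal.mul_mem_left _ (u ^ (q - n * a)) h4
  convert h5 using 1
  obtain ⟨b, hb⟩ := Nat.exists_eq_add_of_le han
  rw [hb, Nat.add_sub_cancel_left]
  ring

end Ideal

/-! ### Reductions with `d` generators -/

namespace MvPolynomial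

theorem aeval_mem_span_range_pow {K R ι : Type*} [CommRing K] [CommRing R] [Algebra K R]
    (g : ι → R) {D : ℕ} {P : MvPolynomial ι K} (hP : P.IsHomogeneous D) :
    aeval g P ∈ Ideal.span (Set.range g) ^ D :=
  (Ideal.mem_span_pow_iff_exists_isHomogeneous g _).mpr
    ⟨map (algebraMap K R) P, hP.map _, by rw [eval_map, aeval_def]⟩

/-- The variable `X` records the degree, as in the Rees algebra. -/
theorem coeff_aeval_C_mul_X {K R ι : Type*} [CommRing K] [CommRing R] [Algebra K R]
    (g : ι → R) (P : MvPolynomial ι K) (D : ℕ) :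
    (aeval (fun i => Polynomial.C (g i) * Polynomial.X) P).coeff D =
      aeval g (homogeneousComponent D P) := by
  classical
  induction P using MvPolynomial.induction_on' with
  | add a b ha hb => simp [ha, hb]
  | monomial α c =>
    have h1 : aeval (fun i => Polynomial.C (g i) * Polynomial.X) (monomial α c) =
        Polynomial.C (aeval g (monomial α c)) * Polynomial.X ^ α.degree := by
      simp only [aeval_monomial, mul_pow, Finsupp.prod, Finset.prod_mul_distrib, map_mul,
        map_prod, map_pow, Finset.prod_pow_eq_pow_sum, Finsupp.degree, mul_assoc]
      rfl
    rw [h1, Polynomial.coeff_C_mul, Polynomial.coeff_X_pow,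
      homogeneousComponent_of_mem (isHomogeneous_monomial c rfl)]
    split_ifs <;> simp

/-- The special fibre of the Rees algebra of an ideal in `d` variables has dimension at most
`d`. -/
theorem exists_isHomogeneous_aeval_mem {K : Type*} [Field K] {d r : ℕ} (hr : d < r)
    (g : Fin r → MvPolynomial (Fin d) K) {b : MvPolynomial (Fin d) K} (hb : b ≠ 0) :
    ∃ (D : ℕ) (P : MvPolynomial (Fin r) K), P.IsHomogeneous D ∧ P ≠ 0 ∧
      aeval g P ∈ Ideal.span {b} * Ideal.span (Set.range g) ^ D := by
  classical
  let φ : MvPolynomial (Fin r) K →ₐ[K] Polynomial (MvPolynomial (Fin d) K) :=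
    aeval (fun i => Polynomial.C (g i) * Polynomial.X)
  let x : Option (Fin r) → Polynomial (MvPolynomial (Fin d) K) :=
    fun o => o.elim (Polynomial.C b) (fun i => Polynomial.C (g i) * Polynomial.X)
  -- These are `r + 1 > d + 1` elements of a domain of transcendence degree `d + 1`.
  have hx : ¬ AlgebraicIndependent K x := by
    intro h
    have h1 := h.lift_cardinalMk_le_trdeg
    rw [← (optionEquivLeft K (Fin d)).trdeg_eq, trdeg_of_isDomain] at h1
    simp only [Cardinal.mk_fintype, Fintype.card_option, Fintype.card_fin] at h1
    simp at h1
    omega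
  obtain ⟨Q, hQ0, hQ⟩ : ∃ Q, aeval x Q = 0 ∧ Q ≠ 0 := by
    simpa [algebraicIndependent_iff] using hx
  have hφ : ∀ Q, aeval x Q =
      Polynomial.eval₂ (φ : _ →+* _) (Polynomial.C b) (optionEquivLeft K (Fin r) Q) := by
    intro Q
    have : (aeval x : MvPolynomial (Option (Fin r)) K →ₐ[K] _).toRingHom =
        (Polynomial.eval₂RingHom (φ : _ →+* _) (Polynomial.C b)).comp
          (optionEquivLeft K (Fin r)).toRingEquiv.toRingHom := by
      refine ringHom_ext (fun c => ?_) (fun o => ?_)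
      · simp [optionEquivLeft_C]
      · cases o <;> simp [x, φ]
    exact DFunLike.congr_fun this Q
  rw [hφ] at hQ0
  have hQ' : optionEquivLeft K (Fin r) Q ≠ 0 := by simpa using hQ
  -- Since `b ≠ 0`, the relation may be divided by the highest power of the variable standing for
  -- `b`, leaving a nonzero constant term.
  obtain ⟨S, hS, hS0⟩ := Polynomial.exists_eq_pow_rootMultiplicity_mul_and_not_dvd _ hQ' 0
  rw [map_zero, sub_zero] at hS hS0
  rw [hS, Polynomial.eval₂_mul, Polynomial.eval₂_X_pow] at hQ0
  have hSb := (mul_eq_zero.mp hQ0).resolve_left (pow_ne_zero _ (by simpa using hb))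
  rw [Polynomial.X_dvd_iff] at hS0
  obtain ⟨D, hD⟩ : ∃ D, homogeneousComponent D (S.coeff 0) ≠ 0 := by
    by_contra! h
    apply hS0
    rw [← sum_homogeneousComponent (S.coeff 0)]
    exact Finset.sum_eq_zero fun i _ => h i
  refine ⟨D, _, homogeneousComponent_isHomogeneous D _, hD, ?_⟩
  rw [Polynomial.eval₂_eq_sum_range, Finset.sum_range_succ'] at hSb
  -- In the coefficient of `X ^ D` all terms but the constant one carry a factor `b`.
  have hc := congrArg (fun f => Polynomial.coeff f D) hSb
  simp only [← map_pow, Polynomial.coeff_add, Polynomial.finsetSum_coeff, Polynomial.coeff_mul_C,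
    φ, coeff_aeval_C_mul_X, Polynomial.coeff_zero, pow_zero, mul_one,
    RingHom.coe_coe] at hc
  rw [add_comm, add_eq_zero_iff_eq_neg] at hc
  rw [hc]
  refine neg_mem (Ideal.sum_mem _ fun i _ => ?_)
  rw [pow_succ', mul_left_comm]
  exact Ideal.mul_mem_mul (Ideal.mem_span_singleton_self b) (Ideal.mul_mem_right _ _
    (aeval_mem_span_range_pow g (homogeneousComponent_isHomogeneous D _)))

end MvPolynomial

namespace MvPolynomial

theorem aeval_algebraMap_mul_of_isHomogeneous {K R ι : Type*} [CommRing K] [CommRing R] [Algebra K R]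
    {P : MvPolynomial ι K} {D : ℕ} (hP : P.IsHomogeneous D) (c : ι → K) (y : R) :
    aeval (fun i => algebraMap K R (c i) * y) P = algebraMap K R (eval c P) * y ^ D := by
  rw [aeval_eq_eval₂Hom, coe_eval₂Hom, eval₂_eq, eval_eq, map_sum, Finset.sum_mul]
  refine Finset.sum_congr rfl fun α hα => ?_
  have h := hP (mem_support_iff.mp hα)
  rw [Finsupp.weight_apply, Finsupp.sum] at h
  simp only [Pi.one_apply, smul_eq_mul, mul_one] at h
  simp_rw [mul_pow, Finset.prod_mul_distrib, Finset.prod_pow_eq_pow_sum, h, map_mul, map_prod,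
    map_pow, mul_assoc]

/-- Replacing the factors of a monomial one at a time costs one factor in `J` and leaves `D - 1` in
`I`. For `D = 0` the difference vanishes. -/
theorem aeval_sub_aeval_mem_of_isHomogeneous {K R ι : Type*} [CommRing K] [CommRing R] [Algebra K R]
    {P : MvPolynomial ι K} {D : ℕ} (hP : P.IsHomogeneous D) {I J : Ideal R} {x z : ι → R}
    (hx : ∀ i, x i ∈ I) (hz : ∀ i, z i ∈ I) (hxz : ∀ i, x i - z i ∈ J) :
    aeval x P - aeval z P ∈ J * I ^ (D - 1) := by
  have key : ∀ (n : ℕ) (α : ι →₀ ℕ), α.degree = n → (α.prod fun i n => x i ^ n) ∈ I ^ n ∧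
      (α.prod fun i n => x i ^ n) - (α.prod fun i n => z i ^ n) ∈ J * I ^ (n - 1) := by
    intro n
    induction n with
    | zero => intro α hα; obtain rfl := (Finsupp.degree_eq_zero_iff α).mp hα; simp
    | succ n ih =>
      intro α hα
      obtain ⟨i, hi⟩ : ∃ i, α i ≠ 0 := by
        by_contra! h
        rw [show α = 0 from Finsupp.ext h, map_zero] at hα
        omega
      obtain ⟨β, rfl⟩ : ∃ β, α = β + Finsupp.single i 1 :=
        ⟨_, (Finsupp.sub_add_single_one_cancel hi).symm⟩
      rw [map_add, Finsupp.degree_single, Nat.add_right_cancel_iff] at hα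
      obtain ⟨h1, h2⟩ := ih β hα
      have hprod : ∀ x : ι → R, ((β + Finsupp.single i 1).prod fun i n => x i ^ n) =
          (β.prod fun i n => x i ^ n) * x i := fun x => by
        classical
        rw [Finsupp.prod_add_index' (by simp) (by simp [pow_add]),
          Finsupp.prod_single_index (h := fun i n => x i ^ n) (pow_zero _), pow_one]
      rw [hprod, hprod]
      refine ⟨by rw [pow_succ]; exact Ideal.mul_mem_mul h1 (hx i), ?_⟩
      generalize hX : (β.prod fun i n => x i ^ n) = X at *
      generalize hZ : (β.prod fun i n => z i ^ n) = Z at *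
      rw [show X * x i - Z * z i = (x i - z i) * X + (X - Z) * z i by ring]
      refine add_mem (Ideal.mul_mem_mul (hxz i) h1) ?_
      rcases n with _ | n
      · obtain rfl := (Finsupp.degree_eq_zero_iff β).mp hα
        rw [← hX, ← hZ]
        simp
      · rw [Nat.add_sub_cancel] at h2 ⊢
        rw [pow_succ, ← mul_assoc]
        exact Ideal.mul_mem_mul h2 (hz i)
  rw [aeval_eq_eval₂Hom, aeval_eq_eval₂Hom, coe_eval₂Hom, coe_eval₂Hom, eval₂_eq, eval₂_eq,
    ← Finset.sum_sub_distrib]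
  refine Ideal.sum_mem _ fun α hα => ?_
  have h := hP (mem_support_iff.mp hα)
  rw [← mul_sub]
  refine Ideal.mul_mem_left _ _ ?_
  refine (key D α ?_).2
  rwa [Finsupp.degree_eq_weight_one]

end MvPolynomial

namespace Ideal

/-- A product of `t + 1` factors either uses one from `I` or has all of them in `J`. -/
theorem sup_pow_succ_le {R : Type*} [CommRing R] (I J : Ideal R) (t : ℕ) :
    (I ⊔ J) ^ (t + 1) ≤ I * (I ⊔ J) ^ t ⊔ J ^ (t + 1) := by
  induction t with
  | zero => simp
  | succ t ih =>
    rw [pow_succ']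
    calc (I ⊔ J) * (I ⊔ J) ^ (t + 1)
        ≤ I * (I ⊔ J) ^ (t + 1) ⊔ J * (I * (I ⊔ J) ^ t ⊔ J ^ (t + 1)) := by
          rw [sup_mul]; gcongr
      _ ≤ _ := by
          rw [mul_sup, ← mul_assoc, mul_comm J I, mul_assoc, pow_succ' J (t + 1),
            pow_succ' (I ⊔ J) t]
          refine sup_le le_sup_left (sup_le (le_sup_of_le_left ?_) le_sup_right)
          gcongr
          exact le_sup_right

open MvPolynomial Pointwise in
/-- A generic linear change of generators drops one generator from a reduction. -/
theorem exists_reduction_of_isHomogeneous {K R : Type*} [Field K] [Infinite K] [CommRing R]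
    [Algebra K R] {r D : ℕ} (g : Fin (r + 1) → R) (b : R) {P : MvPolynomial (Fin (r + 1)) K}
    (hP : P.IsHomogeneous D) (hP0 : P ≠ 0)
    (hPg : aeval g P ∈ span {b} * span (Set.range g) ^ D) :
    ∃ (g' : Fin r → R) (w : R) (t : ℕ), (∀ i, g' i ∈ span (Set.range g)) ∧ w - 1 ∈ span {b} ∧
      span {w} * span (Set.range g) ^ (t + 1) ≤ span (Set.range g') * span (Set.range g) ^ t := by
  set I := span (Set.range g) with hI
  have hgI : ∀ i, g i ∈ I := fun i => subset_span ⟨i, rfl⟩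
  -- The extra variable forces the last coordinate of a point of nonvanishing to be nonzero, so that
  -- it can be scaled to 1.
  have hPX : (P * X (Fin.last r)).IsHomogeneous (D + 1) := hP.mul (isHomogeneous_X _ _)
  obtain ⟨c₀, hc₀⟩ : ∃ c, eval c (P * X (Fin.last r)) ≠ 0 := by
    by_contra! h
    exact mul_ne_zero hP0 (X_ne_zero _) (MvPolynomial.funext fun x => by rw [h x, map_zero])
  have hlast : c₀ (Fin.last r) ≠ 0 := fun h => hc₀ (by simp [h])
  let c : Fin (r + 1) → K := fun i => c₀ i * (c₀ (Fin.last r))⁻¹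
  have hc : eval c (P * X (Fin.last r)) ≠ 0 := by
    have := aeval_algebraMap_mul_of_isHomogeneous hPX c₀ (c₀ (Fin.last r))⁻¹
    simp only [Algebra.algebraMap_self, RingHom.id_apply] at this
    simp only [c]
    erw [this]
    exact mul_ne_zero hc₀ (pow_ne_zero _ (inv_ne_zero hlast))
  have hcl : c (Fin.last r) = 1 := mul_inv_cancel₀ hlast
  let y := g (Fin.last r)
  let g' : Fin r → R := fun i => g i.castSucc - algebraMap K R (c i.castSucc) * y
  set J := span (Set.range g') with hJ
  have hdiff : ∀ i, g i - algebraMap K R (c i) * y ∈ J := by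
    intro i
    refine Fin.lastCases ?_ (fun i => ?_) i
    · rw [hcl, map_one, one_mul, sub_self]; exact J.zero_mem
    · exact subset_span ⟨i, rfl⟩
  have hg' : ∀ i, g' i ∈ I := fun i => sub_mem (hgI _) (mul_mem_left _ _ (hgI _))
  have hIJ : I = J ⊔ span {y} := by
    refine le_antisymm (span_le.mpr ?_) (sup_le (span_le.mpr ?_) (span_le.mpr ?_))
    · rintro _ ⟨i, rfl⟩
      rw [← sub_add_cancel (g i) (algebraMap K R (c i) * y)]
      exact add_mem (mem_sup_left (hdiff i))
        (mem_sup_right (mul_mem_left _ _ (mem_span_singleton_self y)))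
    · rintro _ ⟨i, rfl⟩; exact hg' i
    · rintro _ rfl; exact hgI _
  -- Modulo `J` each `g i` is `c i` times `y`, so the value at `g` becomes a unit times `y ^ (D +
  -- 1)`.
  have hy : y ^ (D + 1) ∈ J * I ^ D ⊔ span {b} • I ^ (D + 1) := by
    have h1 := aeval_sub_aeval_mem_of_isHomogeneous hPX hgI
      (fun i => mul_mem_left _ (algebraMap K R (c i)) (hgI (Fin.last r))) hdiff
    rw [aeval_algebraMap_mul_of_isHomogeneous hPX, Nat.add_sub_cancel] at h1
    have h2 : aeval g (P * X (Fin.last r)) ∈ span {b} * I ^ (D + 1) := by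
      rw [map_mul, aeval_X, pow_succ, ← mul_assoc]
      exact mul_mem_mul hPg (hgI _)
    have h3 : algebraMap K R (eval c (P * X (Fin.last r))) * y ^ (D + 1) ∈
        J * I ^ D ⊔ span {b} • I ^ (D + 1) := by
      rw [← sub_sub_cancel (aeval g (P * X (Fin.last r))) (_ * _)]
      exact sub_mem (mem_sup_right h2) (mem_sup_left h1)
    exact (unit_mul_mem_iff_mem _ (IsUnit.map _ (IsUnit.mk0 _ hc))).mp h3
  have hle : I ^ (D + 1) ≤ J * I ^ D ⊔ span {b} • I ^ (D + 1) := by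
    conv_lhs => rw [hIJ]
    refine (sup_pow_succ_le J (span {y}) D).trans (sup_le ?_ ?_)
    · rw [← hIJ]; exact le_sup_left
    · rw [span_singleton_pow, span_le, Set.singleton_subset_iff]; exact hy
  have hfg : (I ^ (D + 1)).FG := by
    refine FG.pow ?_
    rw [hI]
    exact Submodule.fg_span (Set.finite_range g)
  -- Nakayama's lemma absorbs the term with `b`.
  obtain ⟨w, hw1, hw⟩ :=
    Submodule.exists_sub_one_mem_and_smul_le_of_fg_of_le_sup hfg le_rfl hle
  refine ⟨g', w, D, hg', hw1, ?_⟩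
  rw [mul_le]
  intro a ha x hx
  obtain ⟨a, rfl⟩ := mem_span_singleton'.mp ha
  rw [mul_assoc]
  exact mul_mem_left _ _ (hw (Submodule.smul_mem_pointwise_smul x w _ hx))

/-- Over an infinite field, an ideal of a polynomial ring in `d` variables has a reduction with
`d` generators after inverting a suitable element that is `1` modulo a given `b ≠ 0`. -/
theorem exists_reduction_of_fin_generators {K : Type*} [Field K] [Infinite K] {d r : ℕ} (hr : d ≤ r)
    (g : Fin r → MvPolynomial (Fin d) K) {b : MvPolynomial (Fin d) K} (hb : b ≠ 0) :
    ∃ (j : Fin d → MvPolynomial (Fin d) K) (w : MvPolynomial (Fin d) K) (t : ℕ),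
      (∀ i, j i ∈ span (Set.range g)) ∧ w - 1 ∈ span {b} ∧
      span {w} * span (Set.range g) ^ (t + 1) ≤ span (Set.range j) * span (Set.range g) ^ t := by
  induction r, hr using Nat.le_induction with
  | base => exact ⟨g, 1, 0, fun i => subset_span ⟨i, rfl⟩, by simp, by simp [one_eq_top]⟩
  | succ r hr ih =>
    obtain ⟨D, P, hP, hP0, hPg⟩ := MvPolynomial.exists_isHomogeneous_aeval_mem
      (Nat.lt_succ_of_le hr) g hb
    obtain ⟨g', w, t, hg', hw1, hw⟩ := exists_reduction_of_isHomogeneous g b hP hP0 hPg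
    obtain ⟨j, w', t', hj, hw1', hw'⟩ := ih g'
    have hJI : span (Set.range g') ≤ span (Set.range g) :=
      span_le.mpr (Set.range_subset_iff.mpr hg')
    set I := span (Set.range g)
    set J := span (Set.range g')
    -- The power of `w` turns `I^(t+t'+1)` into `J^(t'+1) I^t`, to which the reduction of `J`
    -- applies.
    refine ⟨j, w' * w ^ (t' + 1), t + t', fun i => hJI (hj i), ?_, ?_⟩
    · rw [← Quotient.eq] at hw1 hw1' ⊢
      simp [hw1, hw1']
    · calc span {w' * w ^ (t' + 1)} * I ^ (t + t' + 1)
          = span {w'} * (span {w ^ (t' + 1)} * I ^ (t + (t' + 1))) := by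
            rw [← span_singleton_mul_span_singleton, mul_assoc, add_assoc]
        _ ≤ span {w'} * (J ^ (t' + 1) * I ^ t) := by
            exact Ideal.mul_mono_right (span_singleton_pow_mul_pow_le hw _)
        _ = span {w'} * J ^ (t' + 1) * I ^ t := (mul_assoc _ _ _).symm
        _ ≤ span (Set.range j) * J ^ t' * I ^ t := by gcongr
        _ ≤ span (Set.range j) * I ^ t' * I ^ t := by gcongr
        _ = span (Set.range j) * I ^ (t + t') := by ring

theorem exists_reduction {K : Type*} [Field K] [Infinite K] {d : ℕ}
    (I : Ideal (MvPolynomial (Fin d) K)) {b : MvPolynomial (Fin d) K} (hb : b ≠ 0) :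
    ∃ (j : Fin d → MvPolynomial (Fin d) K) (w : MvPolynomial (Fin d) K) (t : ℕ),
      (∀ i, j i ∈ I) ∧ w - 1 ∈ span {b} ∧
      span {w} * I ^ (t + 1) ≤ span (Set.range j) * I ^ t := by
  obtain ⟨r, g, hg⟩ := Submodule.fg_iff_exists_fin_generating_family.mp
    (IsNoetherian.noetherian I)
  -- Padding with `d` zeros makes the number of generators at least `d`.
  have hI : I = span (Set.range (Fin.append g (0 : Fin d → MvPolynomial (Fin d) K))) := by
    refine le_antisymm ?_ (span_le.mpr ?_)
    · rw [← hg]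
      refine span_le.mpr ?_
      rintro _ ⟨i, rfl⟩
      exact subset_span ⟨Fin.castAdd d i, by simp⟩
    · rintro _ ⟨i, rfl⟩
      refine Fin.addCases (fun i => ?_) (fun i => ?_) i
      · rw [Fin.append_left, ← hg]
        exact subset_span ⟨i, rfl⟩
      · rw [Fin.append_right]
        exact I.zero_mem
  rw [hI]
  exact exists_reduction_of_fin_generators (Nat.le_add_left _ _) _ hb

end Ideal

/-! ### Symbolic powers and nonzerodivisors -/

namespace Ideal

/-- An element of a symbolic power of an unmixed ideal lies in the ordinary power up to a
nonzerodivisor modulo the ideal. -/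
theorem exists_mul_mem_pow_of_mem_symbolicPower {R : Type*} [CommRing R] [IsNoetherianRing R]
    {I : Ideal R} (hI : I.IsUnmixed) {N : ℕ} (hN : N ≠ 0) {u : R}
    (hu : u ∈ I.symbolicPower N) :
    ∃ s, (∀ h, s * h ∈ I → h ∈ I) ∧ s * u ∈ I ^ N := by
  let A : Ideal R := Submodule.comap (LinearMap.mulRight R u) (I ^ N)
  have hA : ∀ s, s ∈ A ↔ s * u ∈ I ^ N := fun s => by simp [A]
  have hfin := associatedPrimes.finite R (R ⧸ I)
  -- Prime avoidance: otherwise `A` lies in one associated prime, which is minimal over `I ^ N`,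
  -- against `hu`.
  have hnot : ¬ (A : Set R) ⊆ ⋃ P ∈ (hfin.toFinset : Set (Ideal R)), (P : Set R) := by
    rw [subset_union_prime (f := fun P => P) ⊥ ⊥
      (fun P hP _ _ => ((Set.Finite.mem_toFinset hfin).mp hP).isPrime)]
    rintro ⟨P, hP, hAP⟩
    have hmin := hI P ((Set.Finite.mem_toFinset hfin).mp hP)
    rw [← radical_minimalPrimes, ← radical_pow I hN, radical_minimalPrimes] at hmin
    have : P.IsPrime := hmin.1.1
    rw [symbolicPower] at hu
    simp only [Submodule.mem_iInf] at hu
    obtain ⟨s, hs, hsu⟩ := mem_localContraction.mp (hu P hmin)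
    exact hs (hAP ((hA s).mpr hsu))
  obtain ⟨s, hsA, hs⟩ := Set.not_subset.mp hnot
  refine ⟨s, fun h hsh => ?_, (hA s).mp hsA⟩
  by_contra hh
  apply hs
  have : s ∈ {r : R | ∃ x : R ⧸ I, x ≠ 0 ∧ r • x = 0} :=
    ⟨Quotient.mk I h, by rwa [Ne, Quotient.eq_zero_iff_mem], by
      rw [← Quotient.eq_zero_iff_mem, map_mul] at hsh; exact hsh⟩
  rw [← biUnion_associatedPrimes_eq_zero_divisors] at this
  simpa using this

end Ideal

/-! ### Extension of the base field -/

namespace MvPolynomial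

section FieldExtension

variable {σ K L : Type*} [CommRing K] [CommRing L] [Algebra K L]

/-- Apply a linear form to all coefficients. -/
noncomputable def mapCoeff (f : L →ₗ[K] K) (h : MvPolynomial σ L) : MvPolynomial σ K :=
  AddMonoidAlgebra.ofCoeff ((AddMonoidAlgebra.coeff h).mapRange f (map_zero f))

theorem coeff_mapCoeff (f : L →ₗ[K] K) (h : MvPolynomial σ L) (γ : σ →₀ ℕ) :
    coeff γ (mapCoeff f h) = f (coeff γ h) := rfl

theorem mapCoeff_map_mul (f : L →ₗ[K] K) (g : MvPolynomial σ K) (h : MvPolynomial σ L) :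
    mapCoeff f (map (algebraMap K L) g * h) = g * mapCoeff f h := by
  classical
  ext γ
  simp only [coeff_mapCoeff, coeff_mul, coeff_map, map_sum, ← Algebra.smul_def, map_smul,
    smul_eq_mul]

theorem mapCoeff_mem_of_mem_map (f : L →ₗ[K] K) {I : Ideal (MvPolynomial σ K)}
    {h : MvPolynomial σ L} (hh : h ∈ I.map (map (algebraMap K L))) : mapCoeff f h ∈ I := by
  suffices H : ∀ r, mapCoeff f (r * h) ∈ I by simpa using H 1
  induction hh using Submodule.span_induction with
  | mem x hx =>
    obtain ⟨y, hy, rfl⟩ := hx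
    intro r
    rw [mul_comm, mapCoeff_map_mul]
    exact I.mul_mem_right _ hy
  | zero =>
    intro r
    rw [mul_zero, show mapCoeff f (0 : MvPolynomial σ L) = 0 by ext; simp [coeff_mapCoeff]]
    exact I.zero_mem
  | add x y _ _ hx hy =>
    intro r
    rw [mul_add, show ∀ a b : MvPolynomial σ L, mapCoeff f (a + b) = mapCoeff f a + mapCoeff f b
      by intros; ext; simp [coeff_mapCoeff]]
    exact I.add_mem (hx r) (hy r)
  | smul s x _ hx => intro r; rw [smul_eq_mul, ← mul_assoc]; exact hx _

end FieldExtension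

variable {σ K L : Type*} [Field K] [Field L] [Algebra K L]

/-- A `K`-linear retraction of `L` onto `K`, applied to coefficients, carries the extended ideal
back into `I`. -/
theorem map_mem_map_iff (I : Ideal (MvPolynomial σ K)) (y : MvPolynomial σ K) :
    map (algebraMap K L) y ∈ I.map (map (algebraMap K L)) ↔ y ∈ I := by
  refine ⟨fun h => ?_, fun h => Ideal.mem_map_of_mem _ h⟩
  obtain ⟨f, hf⟩ := (Algebra.linearMap K L).exists_leftInverse_of_injective
    (LinearMap.ker_eq_bot.mpr (algebraMap K L).injective)
  have h1 := mapCoeff_mem_of_mem_map f h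
  rw [← mul_one (map (algebraMap K L) y), mapCoeff_map_mul] at h1
  have h2 : mapCoeff f (1 : MvPolynomial σ L) = 1 := by
    classical
    ext γ
    have hf1 : f 1 = 1 := by simpa using LinearMap.congr_fun hf 1
    rw [coeff_mapCoeff, coeff_one, coeff_one]
    split_ifs <;> simp [hf1]
  rwa [h2, mul_one] at h1

/-- Coordinates in a `K`-basis of `L` commute with multiplication by `s`, which has coefficients in
`K`. -/
theorem mem_map_of_mul_mem_map {I : Ideal (MvPolynomial σ K)} {s : MvPolynomial σ K}
    (hs : ∀ h, s * h ∈ I → h ∈ I) {h : MvPolynomial σ L}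
    (hh : map (algebraMap K L) s * h ∈ I.map (map (algebraMap K L))) :
    h ∈ I.map (map (algebraMap K L)) := by
  classical
  let e := Module.Free.chooseBasis K L
  have h1 : ∀ i, mapCoeff (e.coord i) h ∈ I := fun i => hs _ (by
    rw [← mapCoeff_map_mul]; exact mapCoeff_mem_of_mem_map _ hh)
  let S := h.support.biUnion fun γ => (e.repr (coeff γ h)).support
  have h2 : h = ∑ i ∈ S, C (e i) * map (algebraMap K L) (mapCoeff (e.coord i) h) := by
    ext γ
    simp only [coeff_sum, coeff_C_mul, coeff_map, coeff_mapCoeff, Module.Basis.coord_apply]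
    by_cases hγ : γ ∈ h.support
    · conv_lhs => rw [← e.linearCombination_repr (coeff γ h), Finsupp.linearCombination_apply]
      rw [Finsupp.sum_of_support_subset (s := S)]
      · exact Finset.sum_congr rfl fun i _ => by rw [Algebra.smul_def, mul_comm]
      · exact Finset.subset_biUnion_of_mem (fun γ => (e.repr (coeff γ h)).support) hγ
      · simp
    · rw [notMem_support_iff.mp hγ]; simp
  rw [h2]
  exact Ideal.sum_mem _ fun i _ => Ideal.mul_mem_left _ _ (Ideal.mem_map_of_mem _ (h1 i))

end MvPolynomial

/-! ### Generic freeness and specialization -/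

namespace MvPolynomial

open MonomialOrder

theorem degree_sub_lt_of_coeff_eq_zero {σ A : Type*} [CommRing A] (m : MonomialOrder σ)
    {f g : MvPolynomial σ A} {α : σ →₀ ℕ} (hf : m.degree f ≼[m] α) (hg : m.degree g ≼[m] α)
    (h : coeff α f = coeff α g) (hne : f - g ≠ 0) : m.degree (f - g) ≺[m] α := by
  refine lt_of_le_of_ne (m.degree_sub_le.trans (sup_le hf hg)) fun heq => ?_
  have h1 := m.degree_mem_support hne
  rw [m.toSyn.injective heq, mem_support_iff, coeff_sub, h, sub_self] at h1
  exact h1 rfl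

theorem support_add_monomial_subset {σ A : Type*} [CommRing A] {f : MvPolynomial σ A}
    {Δ : Set (σ →₀ ℕ)} (hf : (f.support : Set (σ →₀ ℕ)) ⊆ Δ) {γ : σ →₀ ℕ} (hγ : γ ∈ Δ) (c : A) :
    ((f + monomial γ c).support : Set (σ →₀ ℕ)) ⊆ Δ := by
  classical
  intro δ hδ
  rcases Finset.mem_union.mp (support_add hδ) with h | h
  · exact hf h
  · rw [Finset.mem_singleton.mp (support_monomial_subset h)]; exact hγ

/-- Generic freeness of a quotient of a polynomial ring over a domain: after inverting one element
`a` of the base, the monomials with exponents in `Δ` form a basis of the quotient by `J`. -/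
theorem exists_generic_basis {σ A : Type*} [Finite σ] [CommRing A] [IsDomain A]
    (J : Ideal (MvPolynomial σ A)) :
    ∃ (a : A) (Δ : Set (σ →₀ ℕ)), a ≠ 0 ∧
      (∀ r : MvPolynomial σ A, ∃ (N : ℕ) (i τ : MvPolynomial σ A), i ∈ J ∧
        (τ.support : Set (σ →₀ ℕ)) ⊆ Δ ∧ C (a ^ N) * r = i + τ) ∧
      ∀ τ ∈ J, (τ.support : Set (σ →₀ ℕ)) ⊆ Δ → τ = 0 := by
  classical
  obtain ⟨_, _⟩ : ∃ _ : LinearOrder σ, WellFoundedGT σ := by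
    obtain ⟨n, ⟨e⟩⟩ := Finite.exists_equiv_fin σ
    let o : LinearOrder σ := LinearOrder.lift' e e.injective
    exact ⟨o, inferInstance⟩
  let m : MonomialOrder σ := MonomialOrder.lex
  -- Gröbner division: `E` holds the leading exponents of `J`, Dickson's lemma makes its minimal
  -- elements finite in number, and `a` inverts the leading coefficients of the chosen `f b`. The
  -- set `Δ` will be the complement of `E`.
  let E : Set (σ →₀ ℕ) := {γ | ∃ f ∈ J, f ≠ 0 ∧ m.degree f = γ}
  have hEpwo : E.IsPWO := Set.isPWO_of_wellQuasiOrderedLE E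
  let B : Set (σ →₀ ℕ) := {γ | Minimal (· ∈ E) γ}
  have hBfin : B.Finite :=
    WellQuasiOrderedLE.finite_of_isAntichain (setOfPred_minimal_antichain _)
  have hBE : ∀ b ∈ B, ∃ f ∈ J, f ≠ 0 ∧ m.degree f = b := fun b hb => hb.1
  choose! f hfJ hf0 hfd using hBE
  let a : A := ∏ b ∈ hBfin.toFinset, m.leadingCoeff (f b)
  have ha : a ≠ 0 := Finset.prod_ne_zero_iff.mpr fun b hb =>
    m.leadingCoeff_ne_zero_iff.mpr (hf0 b (by simpa using hb))
  refine ⟨a, Eᶜ, ha, fun r => ?_, fun τ hτ hsupp => ?_⟩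
  · induction h : m.toSyn (m.degree r) using WellFoundedLT.induction generalizing r with
    | _ x ih =>
    subst h
    by_cases hr : r = 0
    · exact ⟨0, 0, 0, J.zero_mem, by simp, by simp [hr]⟩
    set γ := m.degree r with hγ
    by_cases hγE : γ ∈ E
    · obtain ⟨b, hbγ, hb⟩ := hEpwo.exists_le_minimal hγE
      have hbB : b ∈ B := hb
      obtain ⟨c, hc⟩ : m.leadingCoeff (f b) ∣ a :=
        Finset.dvd_prod_of_mem (fun b => m.leadingCoeff (f b)) (by simpa using hbB)
      let g := monomial (γ - b) (c * m.leadingCoeff r) * f b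
      have hgJ : g ∈ J := J.mul_mem_left _ (hfJ b hbB)
      have hγb : γ - b + b = γ := tsub_add_cancel_of_le hbγ
      have h1 : m.degree (C a * r) ≼[m] γ := by
        refine m.degree_mul_le.trans ?_
        rw [m.degree_C, zero_add]
      have h2 : m.degree g ≼[m] γ := by
        refine m.degree_mul_le.trans ?_
        rw [hfd b hbB]
        refine le_of_le_of_eq ?_ (congrArg m.toSyn hγb)
        rw [map_add, map_add]
        exact add_le_add_left (m.degree_monomial_le (c * m.leadingCoeff r)) (m.toSyn b)
      have h3 : coeff γ (C a * r) = coeff γ g := by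
        conv_rhs => rw [← hγb]
        rw [m.coeff_mul_of_add_of_degree_le (m.degree_monomial_le _) (by rw [hfd b hbB]),
          coeff_C_mul, coeff_monomial, if_pos rfl]
        have : coeff b (f b) = m.leadingCoeff (f b) := by
          rw [MonomialOrder.leadingCoeff, hfd b hbB]
        have hr' : coeff γ r = m.leadingCoeff r := rfl
        rw [this, hc, hr']
        ring
      by_cases h0 : C a * r - g = 0
      · exact ⟨1, g, 0, hgJ, by simp, by rw [pow_one, add_zero]; exact sub_eq_zero.mp h0⟩
      · obtain ⟨N, i, τ, hi, hτ, he⟩ :=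
          ih _ (degree_sub_lt_of_coeff_eq_zero m h1 h2 h3 h0) _ rfl
        refine ⟨N + 1, i + C (a ^ N) * g, τ, J.add_mem hi (J.mul_mem_left _ hgJ), hτ, ?_⟩
        rw [pow_succ, C_mul]
        linear_combination he
    · by_cases h0 : r - monomial γ (m.leadingCoeff r) = 0
      · refine ⟨0, 0, 0 + monomial γ (m.leadingCoeff r), J.zero_mem,
          support_add_monomial_subset (by simp) hγE _, ?_⟩
        simpa using sub_eq_zero.mp h0
      · obtain ⟨N, i, τ, hi, hτ, he⟩ := ih _ (degree_sub_lt_of_coeff_eq_zero m le_rfl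
          (m.degree_monomial_le _) (by simp [MonomialOrder.leadingCoeff, ← hγ]) h0) _ rfl
        refine ⟨N, i, τ + monomial γ (a ^ N * m.leadingCoeff r), hi,
          support_add_monomial_subset hτ hγE _, ?_⟩
        rw [← C_mul_monomial]
        linear_combination he
  · by_contra hne
    exact hsupp (m.degree_mem_support hne) ⟨τ, hτ, hne, rfl⟩

/-- The coefficients of `μ` stay visible as factors, so a map killing them kills both sums. -/
theorem exists_generic_expansion {σ A : Type*} [CommRing A] {J : Ideal (MvPolynomial σ A)} {a : A}
    {Δ : Set (σ →₀ ℕ)} (h : ∀ r : MvPolynomial σ A, ∃ (N : ℕ) (i τ : MvPolynomial σ A), i ∈ J ∧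
        (τ.support : Set (σ →₀ ℕ)) ⊆ Δ ∧ C (a ^ N) * r = i + τ) (μ : MvPolynomial σ A) :
    ∃ (N : ℕ) (i τ : (σ →₀ ℕ) → MvPolynomial σ A), (∀ γ, i γ ∈ J) ∧
      (∀ γ, ((τ γ).support : Set (σ →₀ ℕ)) ⊆ Δ) ∧
      C (a ^ N) * μ = ∑ γ ∈ μ.support, C (coeff γ μ) * i γ +
        ∑ γ ∈ μ.support, C (coeff γ μ) * τ γ := by
  choose N i τ hi hτ he using fun γ : σ →₀ ℕ => h (monomial γ 1)
  let M := μ.support.sup N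
  refine ⟨M, fun γ => C (a ^ (M - N γ)) * i γ, fun γ => C (a ^ (M - N γ)) * τ γ,
    fun γ => J.mul_mem_left _ (hi γ), fun γ => ?_, ?_⟩
  · refine subset_trans ?_ (hτ γ)
    intro δ hδ
    simp only [Finset.mem_coe, mem_support_iff, coeff_C_mul] at hδ ⊢
    exact right_ne_zero_of_mul hδ
  · conv_lhs => rw [μ.as_sum, Finset.mul_sum]
    rw [← Finset.sum_add_distrib]
    refine Finset.sum_congr rfl fun γ hγ => ?_
    have hle : N γ ≤ M := Finset.le_sup hγ
    rw [← mul_add, ← mul_add, ← he, C_mul_monomial, C_mul_monomial, C_mul_monomial,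
      C_mul_monomial, ← mul_assoc (a ^ _), ← pow_add, Nat.sub_add_cancel hle, mul_one, mul_comm]

theorem support_sum_C_mul_subset {σ A ι : Type*} [CommRing A] (s : Finset ι) (c : ι → A)
    {τ : ι → MvPolynomial σ A} {Δ : Set (σ →₀ ℕ)}
    (hτ : ∀ γ, ((τ γ).support : Set (σ →₀ ℕ)) ⊆ Δ) :
    ((∑ γ ∈ s, C (c γ) * τ γ).support : Set (σ →₀ ℕ)) ⊆ Δ := by
  intro δ hδ
  rw [Finset.mem_coe, mem_support_iff, coeff_sum] at hδ
  obtain ⟨γ, _, hγ⟩ := Finset.exists_ne_zero_of_sum_ne_zero hδ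
  rw [coeff_C_mul] at hγ
  exact hτ γ (mem_support_iff.mpr (right_ne_zero_of_mul hγ))

/-- Membership in an ideal that fails after every localization of the base fails in almost all
fibres. -/
theorem exists_forall_map_notMem {σ A : Type*} [Finite σ] [CommRing A] [IsDomain A]
    (J : Ideal (MvPolynomial σ A)) (y : MvPolynomial σ A) (hy : ∀ a : A, a ≠ 0 → C a * y ∉ J) :
    ∃ a : A, a ≠ 0 ∧ ∀ {F : Type*} [Field F] (φ : A →+* F), Function.Surjective φ → φ a ≠ 0 →
      map φ y ∉ J.map (map φ) := by
  obtain ⟨a, Δ, ha, h1, h2⟩ := exists_generic_basis J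
  obtain ⟨N, i, τ, hi, hτ, he⟩ := h1 y
  have hτ0 : τ ≠ 0 := by
    rintro rfl
    exact hy _ (pow_ne_zero N ha) (by rwa [he, add_zero])
  obtain ⟨γ₀, hγ₀⟩ := ne_zero_iff.mp hτ0
  refine ⟨a * coeff γ₀ τ, mul_ne_zero ha hγ₀, fun {F} _ φ hφ hφa hmem => ?_⟩
  rw [map_mul] at hφa
  obtain ⟨x, hx, hxy⟩ := (Ideal.mem_map_iff_of_surjective _ (map_surjective φ hφ)).mp hmem
  obtain ⟨M, i', τ', hi', hτ', he'⟩ := exists_generic_expansion h1 (C (a ^ N) * (y - x))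
  set μ := C (a ^ N) * (y - x)
  have hμ : ∀ γ, φ (coeff γ μ) = 0 := fun γ => by
    rw [← coeff_map, map_mul (map φ), map_sub (map φ), hxy, sub_self, mul_zero, coeff_zero]
  -- Two normal forms of the same class modulo `J` agree; applying `φ` then kills the sum and
  -- contradicts the choice of `γ₀`.
  have h3 : C (a ^ M) * τ - ∑ γ ∈ μ.support, C (coeff γ μ) * τ' γ = 0 := by
    refine h2 _ ?_ ?_
    · have h4 : C (a ^ M) * τ - ∑ γ ∈ μ.support, C (coeff γ μ) * τ' γ =
          ∑ γ ∈ μ.support, C (coeff γ μ) * i' γ - C (a ^ M) * i + C (a ^ M) * C (a ^ N) * x := by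
        linear_combination he' + C (a ^ M) * (-he)
      rw [h4]
      exact J.add_mem (J.sub_mem (J.sum_mem fun γ _ => J.mul_mem_left _ (hi' γ))
        (J.mul_mem_left _ hi)) (J.mul_mem_left _ hx)
    · intro δ hδ
      classical
      rcases Finset.mem_union.mp (support_sub σ _ _ hδ) with h | h
      · rw [mem_support_iff, coeff_C_mul] at h
        exact hτ (mem_support_iff.mpr (right_ne_zero_of_mul h))
      · exact support_sum_C_mul_subset _ _ hτ' h
  have h5 := congrArg (fun f => φ (coeff γ₀ f)) h3
  simp only [coeff_sub, coeff_C_mul, coeff_sum, map_sub, map_mul, map_sum, hμ, zero_mul,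
    Finset.sum_const_zero, sub_zero, coeff_zero, map_zero] at h5
  rw [map_pow] at h5
  exact mul_ne_zero (pow_ne_zero M (left_ne_zero_of_mul hφa)) (right_ne_zero_of_mul hφa) h5

/-- A generic nonzerodivisor modulo an ideal specializes to a nonzerodivisor in almost all
fibres. -/
theorem exists_forall_mem_map_of_mul_mem_map {σ A : Type*} [Finite σ] [CommRing A] [IsDomain A]
    (I : Ideal (MvPolynomial σ A)) (s : MvPolynomial σ A)
    (hs : ∀ h, s * h ∈ I → ∃ a : A, a ≠ 0 ∧ C a * h ∈ I) :
    ∃ a : A, a ≠ 0 ∧ ∀ {F : Type*} [Field F] (φ : A →+* F), Function.Surjective φ → φ a ≠ 0 →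
      ∀ h, map φ s * h ∈ I.map (map φ) → h ∈ I.map (map φ) := by
  obtain ⟨a, Δ, ha, h1, h2⟩ := exists_generic_basis I
  -- Freeness modulo `I` bounds the torsion by powers of `a`; freeness modulo `I + (s)` plays the
  -- role of vanishing of Tor.
  obtain ⟨b, Δ', hb, h1', h2'⟩ := exists_generic_basis (I ⊔ Ideal.span {s})
  have hsat : ∀ h, s * h ∈ I → ∃ N, C (a ^ N) * h ∈ I := by
    intro h hsh
    obtain ⟨c, hc, hch⟩ := hs h hsh
    obtain ⟨N, i, τ, hi, hτ, he⟩ := h1 h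
    have h3 : C c * τ = 0 := by
      refine h2 _ ?_ ?_
      · rw [show C c * τ = C (a ^ N) * (C c * h) - C c * i by linear_combination C c * (-he)]
        exact I.sub_mem (I.mul_mem_left _ hch) (I.mul_mem_left _ hi)
      · intro δ hδ
        rw [Finset.mem_coe, mem_support_iff, coeff_C_mul] at hδ
        exact hτ (mem_support_iff.mpr (right_ne_zero_of_mul hδ))
    have h4 : τ = 0 := (mul_eq_zero.mp h3).resolve_left (by simpa using hc)
    exact ⟨N, by rwa [he, h4, add_zero]⟩
  refine ⟨a * b, mul_ne_zero ha hb, fun {F} _ φ hφ hφa h hmem => ?_⟩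
  rw [map_mul] at hφa
  obtain ⟨h, rfl⟩ := map_surjective φ hφ h
  rw [← map_mul] at hmem
  obtain ⟨x, hx, hxy⟩ := (Ideal.mem_map_iff_of_surjective _ (map_surjective φ hφ)).mp hmem
  obtain ⟨N, i, τ, hi, hτ, he⟩ := exists_generic_expansion h1' (s * h - x)
  set μ := s * h - x with hμdef
  have hμ : ∀ γ, φ (coeff γ μ) = 0 := fun γ => by
    rw [← coeff_map, map_sub (map φ), hxy, sub_self, coeff_zero]
  have hμJ : μ ∈ I ⊔ Ideal.span {s} := sub_mem
    (Ideal.mem_sup_right (Ideal.mul_mem_right _ _ (Ideal.mem_span_singleton_self s)))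
    (Ideal.mem_sup_left hx)
  have h0 : ∑ γ ∈ μ.support, C (coeff γ μ) * τ γ = 0 := by
    refine h2' _ ?_ (support_sum_C_mul_subset _ _ hτ)
    rw [← sub_eq_iff_eq_add'.mpr he]
    exact sub_mem (Ideal.mul_mem_left _ _ hμJ)
      (Ideal.sum_mem _ fun γ _ => Ideal.mul_mem_left _ _ (hi γ))
  rw [h0, add_zero] at he
  have hsplit : ∀ γ, ∃ k, i γ - s * k ∈ I := fun γ => by
    obtain ⟨y, hy, z, hz, hyz⟩ := Submodule.mem_sup.mp (hi γ)
    obtain ⟨k, rfl⟩ := Ideal.mem_span_singleton'.mp hz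
    exact ⟨k, by rw [← hyz]; convert hy using 1; ring⟩
  choose k hk using hsplit
  -- Under `φ` this element has the same image as `C (b ^ N) * h`, but `s` times it lies in `I`
  -- itself.
  obtain ⟨M, hM⟩ := hsat (C (b ^ N) * h - ∑ γ ∈ μ.support, C (coeff γ μ) * k γ) (by
    have h5 : s * (C (b ^ N) * h - ∑ γ ∈ μ.support, C (coeff γ μ) * k γ) =
        C (b ^ N) * x + ∑ γ ∈ μ.support, C (coeff γ μ) * (i γ - s * k γ) := by
      have h6 : ∑ γ ∈ μ.support, C (coeff γ μ) * (i γ - s * k γ) =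
          C (b ^ N) * μ - s * ∑ γ ∈ μ.support, C (coeff γ μ) * k γ := by
        rw [he, Finset.mul_sum, ← Finset.sum_sub_distrib]
        exact Finset.sum_congr rfl fun γ _ => by ring
      rw [h6, hμdef]
      ring
    rw [h5]
    exact I.add_mem (I.mul_mem_left _ hx) (I.sum_mem fun γ _ => I.mul_mem_left _ (hk γ)))
  have h7 := Ideal.mem_map_of_mem (map φ) hM
  simp only [map_mul, map_sub, map_sum, map_C, hμ, map_zero, zero_mul, Finset.sum_const_zero,
    sub_zero, map_pow] at h7
  rw [← map_pow C, ← map_pow C, ← mul_assoc, ← map_mul C] at h7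
  exact (Ideal.unit_mul_mem_iff_mem _ (IsUnit.map C (IsUnit.mk0 _ (mul_ne_zero
    (pow_ne_zero _ (left_ne_zero_of_mul hφa)) (pow_ne_zero _ (right_ne_zero_of_mul hφa)))))).mp h7

end MvPolynomial

/-! ### Finite residue fields of finitely generated rings -/

instance Int.isJacobsonRing : IsJacobsonRing ℤ := by
  rw [isJacobsonRing_iff_prime_eq]
  intro P hP
  by_cases hP0 : P = ⊥
  · subst hP0
    rw [eq_bot_iff]
    intro x hx
    -- Here `x * x + 1` is a unit of `ℤ`.
    rcases Int.isUnit_iff.mp (Ideal.mem_jacobson_bot.mp hx x) with h | h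
    · rw [Ideal.mem_bot]; nlinarith
    · nlinarith [mul_self_nonneg x]
  · have := hP.isMaximal hP0
    exact Ideal.jacobson_eq_self_of_isMaximal

/-- By the Jacobson property the maximal ideals meet in zero. A residue field is finite over `ℤ`, so
`ℤ` cannot embed in it: it is torsion and finitely generated. -/
theorem Algebra.FiniteType.exists_isMaximal_notMem_finite_quotient {A : Type*} [CommRing A]
    [IsDomain A] [Algebra.FiniteType ℤ A] {a : A} (ha : a ≠ 0) :
    ∃ m : Ideal A, m.IsMaximal ∧ a ∉ m ∧ Finite (A ⧸ m) := by
  have hJ : IsJacobsonRing A := isJacobsonRing_of_finiteType (A := ℤ)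
  have h1 : a ∉ (⊥ : Ideal A).jacobson := by
    rwa [← Ideal.radical_eq_jacobson, Ideal.isPrime_bot.radical]
  obtain ⟨m, hm, ham⟩ : ∃ m : Ideal A, m.IsMaximal ∧ a ∉ m := by
    simpa [Ideal.jacobson, Submodule.mem_sInf] using h1
  refine ⟨m, hm, ham, ?_⟩
  let := Ideal.Quotient.field m
  have hfin : Module.Finite ℤ (A ⧸ m) := finite_of_finite_type_of_isJacobsonRing ℤ (A ⧸ m)
  refine Module.finite_of_fg_torsion _ ?_
  have hinj : ¬ Function.Injective (algebraMap ℤ (A ⧸ m)) := fun h =>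
    Int.not_isField (isField_of_isIntegral_of_isField h (Field.toIsField (A ⧸ m)))
  rw [injective_iff_map_eq_zero] at hinj
  push Not at hinj
  obtain ⟨n, hn, hn0⟩ := hinj
  intro x
  exact ⟨⟨n, mem_nonZeroDivisors_of_ne_zero hn0⟩, by
    rw [Submonoid.mk_smul, Algebra.smul_def, hn, zero_mul]⟩

/-! ### Descent to a subring of the field -/

namespace MvPolynomial

/-- Membership descends from `L` to the fraction field of `A`, where denominators are cleared. -/
theorem exists_C_mul_mem_of_map_mem_map {σ A L : Type*} [CommRing A] [IsDomain A] [Field L]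
    [Algebra A L] [FaithfulSMul A L] {J : Ideal (MvPolynomial σ A)} {y : MvPolynomial σ A}
    (hy : map (algebraMap A L) y ∈ J.map (map (algebraMap A L))) :
    ∃ a : A, a ≠ 0 ∧ C a * y ∈ J := by
  let K := FractionRing A
  let : Algebra K L := FractionRing.liftAlgebra A L
  let : Algebra (MvPolynomial σ A) (MvPolynomial σ K) := algebraMvPolynomial
  have hcomp : (map (algebraMap A L) : MvPolynomial σ A →+* _) =
      (map (algebraMap K L)).comp (map (algebraMap A K)) := by
    refine RingHom.ext fun f => ?_
    rw [RingHom.comp_apply, map_map, ← IsScalarTower.algebraMap_eq]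
  rw [hcomp, ← Ideal.map_map, RingHom.comp_apply, map_mem_map_iff] at hy
  obtain ⟨_, ⟨a, ha, rfl⟩, h⟩ := (IsLocalization.algebraMap_mem_map_algebraMap_iff
    ((nonZeroDivisors A).map (C : A →+* MvPolynomial σ A)) (MvPolynomial σ K) J y).mp hy
  exact ⟨a, nonZeroDivisors.ne_zero ha, h⟩

theorem exists_span_C_mul_le_of_map_le_map {σ A L : Type*} [CommRing A] [IsDomain A] [Field L]
    [Algebra A L] [FaithfulSMul A L] {P Q : Ideal (MvPolynomial σ A)} (hP : P.FG)
    (h : P.map (map (algebraMap A L)) ≤ Q.map (map (algebraMap A L))) :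
    ∃ a : A, a ≠ 0 ∧ Ideal.span {C a} * P ≤ Q := by
  obtain ⟨S, rfl⟩ := hP
  have hS : ∀ y ∈ S, ∃ a : A, a ≠ 0 ∧ C a * y ∈ Q := fun y hy =>
    exists_C_mul_mem_of_map_mem_map (h (Ideal.mem_map_of_mem _ (Ideal.subset_span hy)))
  choose! a ha haQ using hS
  refine ⟨∏ y ∈ S, a y, Finset.prod_ne_zero_iff.mpr ha, ?_⟩
  rw [Ideal.span_singleton_mul_le_iff]
  intro z hz
  induction hz using Submodule.span_induction with
  | mem y hy =>
    obtain ⟨c, hc⟩ := Finset.dvd_prod_of_mem a hy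
    rw [hc, C_mul, mul_comm (C _), mul_assoc]
    exact Q.mul_mem_left _ (haQ y hy)
  | zero => rw [mul_zero]; exact Q.zero_mem
  | add x y _ _ hx hy => rw [mul_add]; exact Q.add_mem hx hy
  | smul r x _ hx => rw [smul_eq_mul, mul_left_comm]; exact Q.mul_mem_left _ hx

theorem exists_subalgebra_fg_forall_mem_range_map {σ L : Type*} [CommRing L]
    {T : Set (MvPolynomial σ L)} (hT : T.Finite) :
    ∃ A : Subalgebra ℤ L, A.FG ∧ ∀ f ∈ T, ∃ f' : MvPolynomial σ A, map (algebraMap A L) f' = f := by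
  classical
  refine ⟨Algebra.adjoin ℤ (hT.toFinset.biUnion fun f => f.coeffs), ⟨_, rfl⟩, fun f hf => ?_⟩
  refine mem_range_map_iff_coeffs_subset.mpr fun c hc => ?_
  exact ⟨⟨c, Algebra.subset_adjoin
    (Finset.mem_biUnion.mpr ⟨f, (Set.Finite.mem_toFinset hT).mpr hf, hc⟩)⟩, rfl⟩

end MvPolynomial

/-! ### Reduction to finite fields -/

namespace Ideal

open MvPolynomial

/-- The statement of `pow_mul_mem_pow_of_perfectRing` over an arbitrary field, by reduction to
finite fields. -/
theorem pow_mul_mem_pow_of_field {L σ : Type*} [Field L] [Finite σ] {d n t : ℕ} (hd : 0 < d)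
    (hn : 0 < n) {I : Ideal (MvPolynomial σ L)} {s u w : MvPolynomial σ L}
    (hs : ∀ h, s * h ∈ I → h ∈ I) (hsu : s * u ∈ I ^ (d * n)) (j : Fin d → MvPolynomial σ L)
    (hj : ∀ i, j i ∈ I) (hw : span {w} * I ^ (t + 1) ≤ span (Set.range j) * I ^ t) :
    w ^ (d * n) * u ∈ I ^ n := by
  classical
  by_contra hu
  obtain ⟨G, rfl⟩ : I.FG := IsNoetherian.noetherian I
  obtain ⟨A, hAfg, hA⟩ := exists_subalgebra_fg_forall_mem_range_map
    (T := ↑G ∪ Set.range j ∪ {s, u, w})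
    ((G.finite_toSet.union (Set.finite_range j)).union (Set.toFinite _))
  have : Algebra.FiniteType ℤ A := Subalgebra.fg_iff_finiteType A |>.mp hAfg
  have : IsNoetherianRing A := Algebra.FiniteType.isNoetherianRing ℤ A
  obtain ⟨s, rfl⟩ := hA s (by simp)
  obtain ⟨u, rfl⟩ := hA u (by simp)
  obtain ⟨w, rfl⟩ := hA w (by simp)
  have hjA : ∀ i, ∃ f, MvPolynomial.map (algebraMap A L) f = j i := fun i => hA _ (by simp)
  choose jA hjA using hjA
  obtain rfl : j = fun i => MvPolynomial.map (algebraMap A L) (jA i) := funext fun i => (hjA i).symm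
  let Φ : MvPolynomial σ A →+* MvPolynomial σ L := MvPolynomial.map (algebraMap A L)
  let I : Ideal (MvPolynomial σ A) := span (Φ ⁻¹' G)
  have hI : span (G : Set (MvPolynomial σ L)) = I.map Φ := by
    rw [map_span, Set.image_preimage_eq_of_subset]
    exact fun g hg => hA g (by simp [Finset.mem_coe.mp hg])
  have hJ : span (Set.range fun i => Φ (jA i)) = (span (Set.range jA)).map Φ := by
    rw [map_span, ← Set.range_comp]; rfl
  clear_value I
  rw [hI] at hs hsu hj hw hu
  change _ ≤ span (Set.range fun i => Φ (jA i)) * _ at hw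
  rw [hJ, ← Set.image_singleton, ← map_span, ← Ideal.map_pow, ← Ideal.map_pow, ← Ideal.map_mul,
    ← Ideal.map_mul] at hw
  rw [← Ideal.map_pow] at hsu hu
  rw [← map_mul] at hsu
  rw [← map_pow, ← map_mul] at hu
  -- Outside the zeros of `a₁`, `a₂`, `a₃` the memberships specialize; `a₄` keeps `s` a
  -- nonzerodivisor and `a₅` keeps the conclusion false.
  obtain ⟨a₁, ha₁, h₁⟩ := exists_C_mul_mem_of_map_mem_map hsu
  obtain ⟨a₂, ha₂, h₂⟩ := exists_span_C_mul_le_of_map_le_map (IsNoetherian.noetherian _) hw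
  obtain ⟨a₃, ha₃, h₃⟩ := exists_span_C_mul_le_of_map_le_map (P := span (Set.range jA)) (Q := I)
    (L := L) (IsNoetherian.noetherian _) (by
      rw [← hJ, span_le]
      rintro _ ⟨i, rfl⟩
      exact hj i)
  obtain ⟨a₄, ha₄, h₄⟩ := exists_forall_mem_map_of_mul_mem_map I s fun h hsh =>
    exists_C_mul_mem_of_map_mem_map (hs _ (by
      rw [← map_mul]; exact mem_map_of_mem Φ hsh))
  obtain ⟨a₅, ha₅, h₅⟩ := exists_forall_map_notMem (I ^ n) (w ^ (d * n) * u) (by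
    intro a ha hmem
    apply hu
    have h := mem_map_of_mem Φ hmem
    rw [map_mul, map_C] at h
    exact (unit_mul_mem_iff_mem _ (IsUnit.map C (IsUnit.mk0 _ (by simpa using ha)))).mp h)
  obtain ⟨m, hm, ham, hfin⟩ := Algebra.FiniteType.exists_isMaximal_notMem_finite_quotient
    (mul_ne_zero (mul_ne_zero (mul_ne_zero (mul_ne_zero ha₁ ha₂) ha₃) ha₄) ha₅)
  let F := A ⧸ m
  let : Field F := Ideal.Quotient.field m
  let φ : A →+* F := Ideal.Quotient.mk m
  have hφ : Function.Surjective φ := Ideal.Quotient.mk_surjective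
  rw [← Quotient.eq_zero_iff_mem] at ham
  change φ _ ≠ 0 at ham
  simp only [map_mul, mul_ne_zero_iff] at ham
  obtain ⟨⟨⟨⟨h1, h2⟩, h3⟩, h4⟩, h5⟩ := ham
  obtain ⟨p, hp⟩ := CharP.exists F
  have hpp : Fact p.Prime := ⟨(CharP.char_is_prime_or_zero F p).resolve_right
    (CharP.char_ne_zero_of_finite F p)⟩
  have hCunit : ∀ {a : A}, φ a ≠ 0 → IsUnit (MvPolynomial.map φ (C a) : MvPolynomial σ F) := fun h => by
    rw [map_C]; exact IsUnit.map C (IsUnit.mk0 _ h)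
  have hspan : ∀ {a : A}, φ a ≠ 0 → (span {(C a : MvPolynomial σ A)}).map (MvPolynomial.map φ) = ⊤ := fun h => by
    rw [map_span, Set.image_singleton, span_singleton_eq_top]; exact hCunit h
  refine h₅ φ hφ h5 ?_
  rw [Ideal.map_pow, map_mul, map_pow]
  refine pow_mul_mem_pow_of_perfectRing p (t := t) hd hn (h₄ φ hφ h4) ?_
    (fun i => MvPolynomial.map φ (jA i)) ?_ ?_
  · have := mem_map_of_mem (MvPolynomial.map φ) h₁
    rw [map_mul, unit_mul_mem_iff_mem _ (hCunit h1), map_mul, Ideal.map_pow] at this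
    exact this
  · have := map_mono (f := MvPolynomial.map φ) h₃
    rw [Ideal.map_mul, hspan h3, top_mul] at this
    exact fun i => this (mem_map_of_mem _ (subset_span ⟨i, rfl⟩))
  · have := map_mono (f := MvPolynomial.map φ) h₂
    rw [Ideal.map_mul, hspan h2, top_mul, Ideal.map_mul, Ideal.map_mul, Ideal.map_pow,
      Ideal.map_pow, map_span, map_span, ← Set.range_comp, Set.image_singleton] at this
    exact this

end Ideal

theorem mainTheorem3 (k : Type*) [Field k] (d : ℕ) (hd : 0 < d)
    (I : Ideal (MvPolynomial (Fin d) k)) (hI : I.IsUnmixed) (n : ℕ) :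
    I.symbolicPower (d * n) ≤ I ^ n := by
  intro u hu
  rcases Nat.eq_zero_or_pos n with rfl | hn
  · simp
  by_cases hu0 : u = 0
  · rw [hu0]; exact zero_mem _
  have hdn : d * n ≠ 0 := (Nat.mul_pos hd hn).ne'
  obtain ⟨s, hs, hsu⟩ := Ideal.exists_mul_mem_pow_of_mem_symbolicPower hI hdn hu
  have huI : u ∈ I := hs u (Ideal.pow_le_self hdn hsu)
  -- The reduction requires an infinite field.
  let L := AlgebraicClosure k
  let Φ : MvPolynomial (Fin d) k →+* MvPolynomial (Fin d) L := MvPolynomial.map (algebraMap k L)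
  have hb : Φ (u ^ n) ≠ 0 := by
    rw [Ne, map_eq_zero_iff Φ (MvPolynomial.map_injective _ (algebraMap k L).injective)]
    exact pow_ne_zero n hu0
  have hbI : Φ (u ^ n) ∈ I.map Φ ^ n := by
    rw [map_pow]; exact Ideal.pow_mem_pow (Ideal.mem_map_of_mem Φ huI) n
  obtain ⟨j, w, t, hj, hw1, hw⟩ := Ideal.exists_reduction (I.map Φ) hb
  have h := Ideal.pow_mul_mem_pow_of_field hd hn
    (fun _ => MvPolynomial.mem_map_of_mul_mem_map hs)
    (by rw [← map_mul, ← Ideal.map_pow]; exact Ideal.mem_map_of_mem Φ hsu) j hj hw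
  rw [← MvPolynomial.map_mem_map_iff (L := L), Ideal.map_pow]
  -- The choice of `u ^ n` as modulus makes `w` congruent to 1 modulo `I ^ n`, so it can be removed.
  have hw2 : w ^ (d * n) - 1 ∈ I.map Φ ^ n := by
    refine (Ideal.span_singleton_le_iff_mem _).mpr hbI (Ideal.mem_of_dvd _ ?_ hw1)
    simpa using sub_dvd_pow_sub_pow w 1 (d * n)
  have h2 := Ideal.sub_mem _ h (Ideal.mul_mem_right (Φ u) _ hw2)
  convert h2 using 1
  ring
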